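/- Let $k\in\mathbb{N}$ and $a\ge 0$, write points of $\mathbb{R}^{k+1}=\mathbb{R}_r\times\mathbb{R}^k_y$ as $(r,y)$, and let $$L_a u=\partial_{rr}u+\frac{a}{r}\,\partial_r u+\Delta_y u ,\qquad r\neq 0 .$$ Let $\Omega^\star\subset\mathbb{R}^{k+1}$ be a bounded, connected open set that is symmetric with respect to the hyperplane $\{r=0\}$ (that is, $(r,y)\in\Omega^\star$ implies $(-r,y)\in\Omega^\star$), and assume that $$J=\Omega^\star\cap\{(0,y)\mid y\in\mathbb{R}^k\}\neq\varnothing .$$ Let $u\in C^2(\Omega^\star\setminus J)\cap C^1(\Omega^\star)$ be real-valued, and suppose that every point of $J$ has a neighbourhood in which $u(r,y)=u(-r,y)$. If $L_a u\ge 0$ in $\Omega^\star\setminus J$, then $u$ satisfies the strong maximum principle in $\Omega^\star$: if there is a point $x_0\in\Omega^\star$ (possibly with $x_0\in J$) such that $u(x_0)=\sup_{\Omega^\star}u$, then $u$ is constant in $\Omega^\star$. -/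

import Mathlib

open Set Filter Topology

noncomputable section

/-- The space `ℝ^{k+1} = ℝ_r × ℝ^k_y`, with points written `(r, y)`. -/
abbrev WSpace (k : ℕ) : Type := ℝ × EuclideanSpace ℝ (Fin k)

/-- The singular plane `{r = 0}`. -/
def singularPlane (k : ℕ) : Set (WSpace k) := {x | x.1 = 0}

/-- The reflection `(r, y) ↦ (-r, y)` in the singular plane. -/
def reflectR {k : ℕ} (x : WSpace k) : WSpace k := (-x.1, x.2)

/-- The Weinstein operator
`L_a u (r, y) = ∂_rr u (r, y) + (a / r) ∂_r u (r, y) + Δ_y u (r, y)`.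
It is only meant at points with `r ≠ 0` around which `u` is twice continuously differentiable. -/
def weinstein {k : ℕ} (a : ℝ) (u : WSpace k → ℝ) (x : WSpace k) : ℝ :=
  iteratedDeriv 2 (fun s : ℝ => u (s, x.2)) x.1
    + a / x.1 * deriv (fun s : ℝ => u (s, x.2)) x.1
    + Laplacian.laplacian (fun y : EuclideanSpace ℝ (Fin k) => u (x.1, y)) x.2

/-- The strong maximum principle for `u` in `D`: if `u` attains its maximum over `D`
at some point of `D`, then `u` is constant in `D`. -/
def StrongMaxPrinciple {k : ℕ} (u : WSpace k → ℝ) (D : Set (WSpace k)) : Prop :=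
  ∀ x₀ ∈ D, (∀ x ∈ D, u x ≤ u x₀) → ∀ x ∈ D, u x = u x₀

end

/-! The proof is a Hopf-type touching argument carried out in the closed half space `{r ≥ 0}`,
without a separate boundary point lemma.

Evenness enters only through its consequence `∂_r u = 0` on `J`. Let `M` be the maximum, attained
at `x₀` with `r ≥ 0`. If `u < M` at some point `z` with `r ≥ 0` close to `x₀`, then a ball around a
suitable centre with `r ≥ 0` touches the contact set `{u = M} ∩ {r ≥ 0}` in exactly one point `x₁`.
Add to `u` the perturbation `ε exp (-α |x - z|²) + δ r`. For `r > 0` and a centre with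
`z.1 ≥ 0`, the singular term of `L_a` applied to the exponential is bounded below by `-2 α a` times
the exponential, so for large `α` the exponential is a strict subsolution away from `z`, while
`L_a r = a / r ≥ 0`. So the perturbed function has no interior maximum with `r > 0`
(`weinstein_neg_of_isLocalMax`), and none with `r = 0` either, because there its one-sided
`r`-derivative is at least `δ > 0` (`not_eventually_le_of_hasDerivAt_pos`). But for
`ε` and then `δ` small its maximum over a small half ball around `x₁` is larger than its values on
the spherical part of the boundary: a contradiction (`no_touching_point`).

Hence `{u = M}` contains a half neighbourhood of each of its points with `r ≥ 0`; the reflected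
statement covers `r ≤ 0`, since `L_a` commutes with the reflection. So `{u = M}` is open, and it is
closed in the connected set `D`. -/

/-! ### Second derivatives at a maximum -/

theorem deriv_deriv_nonpos_of_isLocalMax {f : ℝ → ℝ} {t : ℝ} (hc : ContinuousAt f t)
    (h : IsLocalMax f t) : deriv (deriv f) t ≤ 0 := by
  by_contra! hpos
  have hmin := isLocalMin_of_deriv_deriv_pos hpos h.deriv_eq_zero hc
  -- a point that is both a local minimum and a local maximum has a constant neighbourhood
  have heq : f =ᶠ[𝓝 t] fun _ => f t := by
    filter_upwards [h, hmin] with s h1 h2 using le_antisymm h1 h2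
  have h2 := heq.deriv.deriv_eq
  simp at h2
  linarith

/-- First and second order conditions for `f` at a local maximum of its perturbation by the
restriction to a line of the barrier `ε exp (-α |x - z|²) + δ r`. -/
theorem deriv_conditions_of_isLocalMax_add {f : ℝ → ℝ} {t ε α b m δ : ℝ} (hf : ContDiffAt ℝ 2 f t)
    (h : IsLocalMax (fun s => f s + (ε * Real.exp (-α * ((s - b) ^ 2 + m)) + δ * s)) t) :
    deriv f t = 2 * α * ε * (t - b) * Real.exp (-α * ((t - b) ^ 2 + m)) - δ ∧
    iteratedDeriv 2 f t ≤
      -(ε * Real.exp (-α * ((t - b) ^ 2 + m)) * (4 * α ^ 2 * (t - b) ^ 2 - 2 * α)) := by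
  set E : ℝ → ℝ := fun s => Real.exp (-α * ((s - b) ^ 2 + m)) with hE
  have hE' : ∀ s, HasDerivAt E (E s * (-α * (2 * (s - b)))) s := by
    intro s
    have h1 : HasDerivAt (fun s : ℝ => -α * ((s - b) ^ 2 + m)) (-α * (2 * (s - b))) s := by
      have := ((((hasDerivAt_id s).sub_const b).pow 2).add_const m).const_mul (-α)
      simpa using this
    exact h1.exp
  have hg : ∀ s, HasDerivAt (fun s => ε * E s + δ * s) (ε * (E s * (-α * (2 * (s - b)))) + δ) s := by
    intro s
    convert! ((hE' s).const_mul ε).add ((hasDerivAt_id s).const_mul δ) using 1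
    rw [mul_one]
  have hg2 : HasDerivAt (fun s => ε * (E s * (-α * (2 * (s - b)))) + δ)
      (ε * E t * (4 * α ^ 2 * (t - b) ^ 2 - 2 * α)) t := by
    have h1 : HasDerivAt (fun s : ℝ => -α * (2 * (s - b))) (-α * 2) t := by
      simpa using (((hasDerivAt_id t).sub_const b).const_mul 2).const_mul (-α)
    convert! (((hE' t).mul h1).const_mul ε).add_const δ using 1
    ring
  have hfd : ∀ᶠ s in 𝓝 t, DifferentiableAt ℝ f s := by
    filter_upwards [hf.eventually (by simp)] with s hs using hs.differentiableAt (by simp)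
  have hd : deriv (fun s => f s + (ε * E s + δ * s)) =ᶠ[𝓝 t]
      fun s => deriv f s + (ε * (E s * (-α * (2 * (s - b)))) + δ) := by
    filter_upwards [hfd] with s hs using (hs.hasDerivAt.add (hg s)).deriv
  have hf2 : DifferentiableAt ℝ (deriv f) t := by
    have := (hf.fderiv_right (m := 1) (by norm_num)).differentiableAt (by simp)
    exact this.clm_apply (differentiableAt_const (1 : ℝ))
  have h0 := h.deriv_eq_zero
  rw [hd.eq_of_nhds] at h0
  have h2 : deriv (deriv (fun s => f s + (ε * E s + δ * s))) t ≤ 0 :=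
    deriv_deriv_nonpos_of_isLocalMax
    (hfd.self_of_nhds.continuousAt.add (hg t).continuousAt) h
  rw [hd.deriv_eq.trans (hf2.hasDerivAt.add hg2).deriv] at h2
  refine ⟨by linarith, ?_⟩
  rw [iteratedDeriv_succ, iteratedDeriv_one]
  linarith

theorem iteratedFDeriv_two_eq_iteratedDeriv_line {E : Type*} [NormedAddCommGroup E]
    [NormedSpace ℝ E] {f : E → ℝ} {x : E} (hf : ContDiffAt ℝ 2 f x) (v : E) :
    iteratedFDeriv ℝ 2 f x ![v, v] = iteratedDeriv 2 (fun t : ℝ => f (x + t • v)) 0 := by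
  have hline : ∀ t : ℝ, HasDerivAt (fun t : ℝ => x + t • v) v t := fun t => by
    simpa using ((hasDerivAt_id t).smul_const v).const_add x
  have hx : Tendsto (fun t : ℝ => x + t • v) (𝓝 0) (𝓝 x) := by
    simpa using (hline 0).continuousAt.tendsto
  have h1 : deriv (fun t : ℝ => f (x + t • v)) =ᶠ[𝓝 0] fun t => fderiv ℝ f (x + t • v) v := by
    filter_upwards [hx.eventually (hf.eventually (by simp))] with t ht
    exact ((ht.differentiableAt (by simp)).hasFDerivAt.comp_hasDerivAt t (hline t)).deriv
  have hf2 : DifferentiableAt ℝ (fderiv ℝ f) (x + (0 : ℝ) • v) := by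
    simpa using (hf.fderiv_right (m := 1) (by norm_num)).differentiableAt (by simp)
  have h2 : HasDerivAt (fun t : ℝ => fderiv ℝ f (x + t • v) v)
      (fderiv ℝ (fderiv ℝ f) x v v) 0 := by
    have := hf2.hasFDerivAt.comp_hasDerivAt (0 : ℝ) (hline 0)
    simpa using this.clm_apply (hasDerivAt_const (0 : ℝ) v)
  rw [iteratedFDeriv_two_apply, iteratedDeriv_succ, iteratedDeriv_one, h1.deriv_eq, h2.deriv]
  simp

/-! ### The barrier -/

/-- The square of the Euclidean norm of `(r, y)`. The norm of the product type `WSpace k` is the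
maximum norm, which is not the one adapted to the barrier. -/
noncomputable def euclidSq {k : ℕ} (x : WSpace k) : ℝ := x.1 ^ 2 + ‖x.2‖ ^ 2

theorem continuous_euclidSq {k : ℕ} : Continuous (euclidSq (k := k)) := by
  unfold euclidSq; fun_prop

theorem euclidSq_pos {k : ℕ} {x : WSpace k} (hx : x ≠ 0) : 0 < euclidSq x := by
  unfold euclidSq
  by_contra! h
  apply hx
  have h1 : x.1 = 0 := by nlinarith [sq_nonneg x.1, sq_nonneg ‖x.2‖]
  have h2 : ‖x.2‖ = 0 := by nlinarith [sq_nonneg x.1, sq_nonneg ‖x.2‖]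
  exact Prod.ext h1 (norm_eq_zero.mp h2)

theorem norm_sq_le_euclidSq {k : ℕ} (x : WSpace k) : ‖x‖ ^ 2 ≤ euclidSq x := by
  unfold euclidSq
  rcases max_choice ‖x.1‖ ‖x.2‖ with h | h <;> rw [Prod.norm_def, h]
  · rw [Real.norm_eq_abs, sq_abs]; nlinarith [sq_nonneg ‖x.2‖]
  · nlinarith [sq_nonneg x.1]

theorem euclidSq_le {k : ℕ} (x : WSpace k) : euclidSq x ≤ 2 * ‖x‖ ^ 2 := by
  unfold euclidSq
  have h1 : x.1 ^ 2 ≤ ‖x‖ ^ 2 := by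
    rw [← sq_abs, ← Real.norm_eq_abs]; gcongr; exact norm_fst_le x
  have h2 : ‖x.2‖ ^ 2 ≤ ‖x‖ ^ 2 := by gcongr; exact norm_snd_le x
  linarith

theorem euclidSq_parallelogram {k : ℕ} (v w : WSpace k) :
    euclidSq (v + w) + euclidSq (v - w) = 2 * (euclidSq v + euclidSq w) := by
  have := parallelogram_law_with_norm ℝ v.2 w.2
  simp only [euclidSq, Prod.fst_add, Prod.snd_add, Prod.fst_sub, Prod.snd_sub]
  nlinarith

/-- At a maximum with `r > 0` of `u` plus the barrier, `L_a u` is negative: the barrier is a strict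
subsolution in `{r > 0}` where `2 α |x - z|² > k + 1 + a`, if its centre satisfies `z.1 ≥ 0`. -/
theorem weinstein_neg_of_isLocalMax {k : ℕ} {a ε α δ : ℝ} {u : WSpace k → ℝ} {p z : WSpace k}
    (ha : 0 ≤ a) (hε : 0 < ε) (hα : 0 < α) (hδ : 0 ≤ δ) (hp : 0 < p.1) (hz : 0 ≤ z.1)
    (hu : ContDiffAt ℝ 2 u p) (hq : (k : ℝ) + 1 + a < 2 * α * euclidSq (p - z))
    (hmax : IsLocalMax (fun x => u x + (ε * Real.exp (-α * euclidSq (x - z)) + δ * x.1)) p) :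
    weinstein a u p < 0 := by
  set E := Real.exp (-α * euclidSq (p - z)) with hE
  have hEpos : 0 < E := Real.exp_pos _
  have hr : ContDiffAt ℝ 2 (fun s : ℝ => u (s, p.2)) p.1 :=
    ContDiffAt.comp p.1 (f := fun s : ℝ => ((s, p.2) : WSpace k)) hu (by fun_prop)
  have hy : ContDiffAt ℝ 2 (fun y : EuclideanSpace ℝ (Fin k) => u (p.1, y)) p.2 :=
    ContDiffAt.comp p.2 (f := fun y => ((p.1, y) : WSpace k)) hu (by fun_prop)
  -- the maximum condition along the `r`-line through `p`
  have hrmax : IsLocalMax (fun s : ℝ => u (s, p.2) +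
      (ε * Real.exp (-α * ((s - z.1) ^ 2 + ‖p.2 - z.2‖ ^ 2)) + δ * s)) p.1 := by
    have hc : Tendsto (fun s : ℝ => ((s, p.2) : WSpace k)) (𝓝 p.1) (𝓝 p) :=
      (by fun_prop : Continuous fun s : ℝ => ((s, p.2) : WSpace k)).continuousAt.tendsto
    exact hc.eventually hmax
  obtain ⟨hr1, hr2⟩ := deriv_conditions_of_isLocalMax_add hr hrmax
  have hEr : Real.exp (-α * ((p.1 - z.1) ^ 2 + ‖p.2 - z.2‖ ^ 2)) = E := rfl
  rw [hEr] at hr1 hr2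
  -- and along the lines through `p` in the coordinate directions of `ℝ^k`
  let e := EuclideanSpace.basisFun (Fin k) ℝ
  have hline : ∀ i, iteratedFDeriv ℝ 2 (fun y : EuclideanSpace ℝ (Fin k) => u (p.1, y)) p.2
      ![e i, e i] ≤ -(ε * E * (4 * α ^ 2 * (inner ℝ (e i) (p.2 - z.2)) ^ 2 - 2 * α)) := by
    intro i
    rw [iteratedFDeriv_two_eq_iteratedDeriv_line hy]
    set c := inner ℝ (e i) (p.2 - z.2) with hc
    have hsq : ∀ t : ℝ, euclidSq ((p.1, p.2 + t • e i) - z) =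
        (t - -c) ^ 2 + (euclidSq (p - z) - c ^ 2) := by
      intro t
      have h1 : p.2 + t • e i - z.2 = t • e i + (p.2 - z.2) := by abel
      have h2 := norm_add_sq_real (t • e i) (p.2 - z.2)
      rw [real_inner_smul_left, norm_smul, e.orthonormal.1 i, ← hc] at h2
      simp only [euclidSq, Prod.fst_sub, Prod.snd_sub, h1, h2]
      simp only [mul_one, Real.norm_eq_abs, sq_abs]
      ring
    have hl : ContDiffAt ℝ 2 (fun t : ℝ => u (p.1, p.2 + t • e i)) 0 := by
      refine ContDiffAt.comp (0 : ℝ) (f := fun t : ℝ => ((p.1, p.2 + t • e i) : WSpace k)) ?_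
        (by fun_prop)
      simpa using hu
    have hlmax : IsLocalMax (fun t : ℝ => u (p.1, p.2 + t • e i) +
        (ε * Real.exp (-α * ((t - -c) ^ 2 + (euclidSq (p - z) - c ^ 2))) + 0 * t)) 0 := by
      have hc' : Tendsto (fun t : ℝ => ((p.1, p.2 + t • e i) : WSpace k)) (𝓝 0) (𝓝 p) := by
        have := (by fun_prop : Continuous
          fun t : ℝ => ((p.1, p.2 + t • e i) : WSpace k)).continuousAt (x := 0)
        simpa [ContinuousAt] using this
      have h1 := hc'.eventually hmax
      filter_upwards [h1] with t ht
      rw [← hsq, ← hsq]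
      simp only [zero_smul, add_zero, zero_mul]
      linarith
    have h2 := (deriv_conditions_of_isLocalMax_add hl hlmax).2
    have hE0 : Real.exp (-α * ((0 - -c) ^ 2 + (euclidSq (p - z) - c ^ 2))) = E := by
      rw [hE]; congr 2; ring
    rw [hE0] at h2
    convert! h2 using 6
    ring
  have hlap : Laplacian.laplacian (fun y : EuclideanSpace ℝ (Fin k) => u (p.1, y)) p.2 ≤
      -(ε * E * (4 * α ^ 2 * ‖p.2 - z.2‖ ^ 2 - 2 * α * k)) := by
    rw [InnerProductSpace.laplacian_eq_iteratedFDeriv_orthonormalBasis _ e]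
    refine (Finset.sum_le_sum fun i _ => hline i).trans (le_of_eq ?_)
    have hs := e.sum_sq_norm_inner_right (p.2 - z.2)
    simp only [Real.norm_eq_abs, sq_abs] at hs
    rw [← hs, Finset.sum_neg_distrib, ← Finset.mul_sum, Finset.sum_sub_distrib, ← Finset.mul_sum,
      Finset.sum_const, Finset.card_univ, Fintype.card_fin, nsmul_eq_mul]
    ring
  have hqdef : euclidSq (p - z) = (p.1 - z.1) ^ 2 + ‖p.2 - z.2‖ ^ 2 := rfl
  -- the singular term is controlled by `(r - z.1) / r ≤ 1`
  have hsing : a / p.1 * deriv (fun s : ℝ => u (s, p.2)) p.1 ≤ 2 * α * ε * E * a := by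
    rw [hr1, div_mul_eq_mul_div, div_le_iff₀ hp]
    have h1 : 0 ≤ 2 * α * ε * E * a * z.1 := by positivity
    have h2 : 0 ≤ a * δ := by positivity
    nlinarith
  have hfin : 0 < 2 * α * ε * E * (2 * α * euclidSq (p - z) - (k + 1 + a)) :=
    mul_pos (by positivity) (by linarith)
  unfold weinstein
  rw [hqdef] at hfin
  nlinarith

/-- A function on `[0, ∞)` with positive derivative at `0` has no local maximum there. -/
theorem not_eventually_le_of_hasDerivAt_pos {f : ℝ → ℝ} {d : ℝ} (hf : HasDerivAt f d 0)
    (hd : 0 < d) : ¬ ∀ᶠ t in 𝓝[>] (0 : ℝ), f t ≤ f 0 := by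
  intro h
  have h1 := (hasDerivAt_iff_tendsto_slope.mp hf).mono_left
    (nhdsWithin_mono (s := Ioi 0) 0 (fun t ht => ne_of_gt ht))
  obtain ⟨t, ht, hle, hpos⟩ := ((h1.eventually_const_lt hd).and
    (h.and self_mem_nhdsWithin)).exists
  have hpos' : (0 : ℝ) < t := hpos
  rw [slope_def_field, sub_zero] at ht
  have : (f t - f 0) / t ≤ 0 := div_nonpos_of_nonpos_of_nonneg (by linarith) hpos'.le
  linarith

/-- On a compact set, a small multiple of `g` keeps `f ≤ 0` strictly negative if `g` is negative
wherever `f` vanishes. -/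
theorem exists_pos_forall_add_mul_neg {X : Type*} [TopologicalSpace X] [T2Space X] {S : Set X}
    (hS : IsCompact S) {f g : X → ℝ} (hf : ContinuousOn f S) (hg : ContinuousOn g S)
    (h : ∀ x ∈ S, f x < 0 ∨ f x ≤ 0 ∧ g x < 0) :
    ∃ ε > 0, ∀ x ∈ S, f x + ε * g x < 0 := by
  rcases (S ∩ g ⁻¹' Ici 0).eq_empty_or_nonempty with hem | hne
  · refine ⟨1, one_pos, fun x hx => ?_⟩
    have hx' : ¬ 0 ≤ g x := fun h0 => (hem ▸ (⟨hx, h0⟩ : x ∈ S ∩ g ⁻¹' Ici 0) : x ∈ (∅ : Set X))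
    rcases h x hx with h1 | h1 <;> linarith
  have hcl : IsCompact (S ∩ g ⁻¹' Ici 0) :=
    hS.of_isClosed_subset (hg.preimage_isClosed_of_isClosed hS.isClosed isClosed_Ici)
      inter_subset_left
  obtain ⟨x₁, hx₁, hm⟩ := hcl.exists_isMaxOn hne (hf.mono inter_subset_left)
  obtain ⟨x₂, hx₂, hG⟩ := hcl.exists_isMaxOn hne (hg.mono inter_subset_left)
  have hneg : f x₁ < 0 := by
    rcases h x₁ hx₁.1 with h1 | h1
    · exact h1
    · exact absurd hx₁.2 (not_le.mpr h1.2)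
  have hG0 : 0 ≤ g x₂ := hx₂.2
  refine ⟨-f x₁ / (g x₂ + 1), div_pos (by linarith) (by linarith), fun x hx => ?_⟩
  have hε : 0 < -f x₁ / (g x₂ + 1) := div_pos (by linarith) (by linarith)
  rcases lt_or_ge (g x) 0 with hgx | hgx
  · have : f x ≤ 0 := by rcases h x hx with h1 | h1 <;> linarith
    nlinarith
  · have h1 : f x ≤ f x₁ := hm ⟨hx, hgx⟩
    have h2 : g x ≤ g x₂ := hG ⟨hx, hgx⟩
    have h3 : -f x₁ / (g x₂ + 1) * (g x₂ + 1) = -f x₁ := by field_simp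
    nlinarith

/-! ### Propagation of the maximum in a half space -/

/-- `u` is a subsolution of `L_a u = 0` in `D ∩ {r > 0}` with vanishing normal derivative on
`D ∩ {r = 0}`. -/
structure HalfSubsolution {k : ℕ} (a : ℝ) (u : WSpace k → ℝ) (D : Set (WSpace k)) : Prop where
  continuousOn : ContinuousOn u D
  contDiffAt : ∀ p ∈ D, 0 < p.1 → ContDiffAt ℝ 2 u p
  weinstein_nonneg : ∀ p ∈ D, 0 < p.1 → 0 ≤ weinstein a u p
  hasDerivAt_zero : ∀ p ∈ D, p.1 = 0 → HasDerivAt (fun s : ℝ => u (s, p.2)) 0 0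

/-- In `{r ≥ 0}`, the contact set `{u = M}` is never touched at exactly one point by a ball with
centre in `{r ≥ 0}`. -/
theorem no_touching_point {k : ℕ} {a M : ℝ} {u : WSpace k → ℝ} {D : Set (WSpace k)} (ha : 0 ≤ a)
    (hu : HalfSubsolution a u D) (hD : IsOpen D) (hM : ∀ x ∈ D, u x ≤ M) {x₁ z : WSpace k}
    (hx₁ : x₁ ∈ D) (hx₁r : 0 ≤ x₁.1) (hux₁ : u x₁ = M) (hz : 0 ≤ z.1) (hne : x₁ ≠ z)
    (hball : ∀ x, 0 ≤ x.1 → euclidSq (x - z) ≤ euclidSq (x₁ - z) → x ≠ x₁ → u x < M) : False := by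
  obtain ⟨ρ₀, hρ₀, hρ₀D⟩ := Metric.isOpen_iff.mp hD x₁ hx₁
  have hdist : 0 < dist x₁ z := dist_pos.mpr hne
  -- a half ball `K` around `x₁` inside `D` that stays away from the centre `z`
  set ρ := min ρ₀ (dist x₁ z) / 2 with hρdef
  have hρ : 0 < ρ := by positivity
  have hρ1 : ρ < ρ₀ := by have := min_le_left ρ₀ (dist x₁ z); linarith [lt_min hρ₀ hdist]
  have hρ2 : ρ < dist x₁ z := by
    have := min_le_right ρ₀ (dist x₁ z); linarith [lt_min hρ₀ hdist]
  have hhalf : IsClosed {x : WSpace k | 0 ≤ x.1} := isClosed_le continuous_const continuous_fst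
  set K := Metric.closedBall x₁ ρ ∩ {x : WSpace k | 0 ≤ x.1} with hK
  set S := Metric.sphere x₁ ρ ∩ {x : WSpace k | 0 ≤ x.1} with hS
  have hKc : IsCompact K := (isCompact_closedBall x₁ ρ).inter_right hhalf
  have hSc : IsCompact S := (isCompact_sphere x₁ ρ).inter_right hhalf
  have hKD : K ⊆ D := fun x hx => hρ₀D (lt_of_le_of_lt hx.1 hρ1)
  have hSK : S ⊆ K := fun x hx => ⟨Metric.sphere_subset_closedBall hx.1, hx.2⟩
  have hx₁K : x₁ ∈ K := ⟨Metric.mem_closedBall_self hρ.le, hx₁r⟩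
  have hsub : Continuous fun x : WSpace k => euclidSq (x - z) :=
    continuous_euclidSq.comp (continuous_id.sub continuous_const)
  have hKpos : ∀ x ∈ K, 0 < euclidSq (x - z) := fun x hx => euclidSq_pos <| sub_ne_zero.mpr <| by
    rintro rfl
    have := hx.1
    rw [Metric.mem_closedBall, dist_comm] at this
    linarith
  obtain ⟨x₂, hx₂, hmin⟩ := hKc.exists_isMinOn ⟨x₁, hx₁K⟩ hsub.continuousOn
  have hc := hKpos x₂ hx₂
  obtain ⟨α, hα, hαc⟩ : ∃ α : ℝ, 0 < α ∧ (k : ℝ) + 1 + a < 2 * α * euclidSq (x₂ - z) := by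
    refine ⟨(k + 1 + a) / euclidSq (x₂ - z), by positivity, ?_⟩
    rw [mul_assoc, div_mul_cancel₀ _ hc.ne']
    have : (0 : ℝ) < k + 1 + a := by positivity
    linarith
  set h : WSpace k → ℝ := fun x => Real.exp (-α * euclidSq (x - z)) with hh
  have hhc : Continuous h := by fun_prop
  have hSne : ∀ x ∈ S, x ≠ x₁ := by
    rintro x hx rfl
    have := hx.1
    simp at this
    linarith
  -- on the spherical part, either `u < M` or the exponential is below its value at `x₁`
  obtain ⟨ε, hε, hεS⟩ := exists_pos_forall_add_mul_neg hSc (f := fun x => u x - M)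
    (g := fun x => h x - h x₁)
    ((hu.continuousOn.mono (hSK.trans hKD)).sub continuousOn_const)
    (hhc.sub continuous_const).continuousOn (by
      intro x hx
      rcases le_or_gt (euclidSq (x - z)) (euclidSq (x₁ - z)) with hle | hgt
      · exact Or.inl (sub_neg.mpr (hball x hx.2 hle (hSne x hx)))
      · refine Or.inr ⟨sub_nonpos.mpr (hM x (hKD (hSK hx))), sub_neg.mpr ?_⟩
        exact Real.exp_lt_exp.mpr (by nlinarith))
  obtain ⟨δ, hδ, hδS⟩ := exists_pos_forall_add_mul_neg hSc
    (f := fun x => u x - M + ε * (h x - h x₁)) (g := fun x => x.1 - x₁.1)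
    (((hu.continuousOn.mono (hSK.trans hKD)).sub continuousOn_const).add
      (by fun_prop : Continuous fun x => ε * (h x - h x₁)).continuousOn)
    (by fun_prop) (fun x hx => Or.inl (hεS x hx))
  obtain ⟨p, hp, hpmax⟩ := hKc.exists_isMaxOn ⟨x₁, hx₁K⟩
    (f := fun x => u x + (ε * h x + δ * x.1))
    ((hu.continuousOn.mono hKD).add (by fun_prop : Continuous
      fun x : WSpace k => ε * h x + δ * x.1).continuousOn)
  have hpball : p ∈ Metric.ball x₁ ρ := by
    by_contra hnot
    have hpS : p ∈ S := ⟨le_antisymm hp.1 (not_lt.mp hnot), hp.2⟩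
    have h1 := hδS p hpS
    have h2 : u x₁ + (ε * h x₁ + δ * x₁.1) ≤ u p + (ε * h p + δ * p.1) := hpmax hx₁K
    nlinarith
  have hnhds : Metric.ball x₁ ρ ∈ 𝓝 p := Metric.isOpen_ball.mem_nhds hpball
  have hp0 : 0 ≤ p.1 := hp.2
  rcases hp0.eq_or_lt with hpr | hpr
  · -- on `{r = 0}` the `r`-derivative of the perturbed function is `2 α ε z.1 h p + δ > 0`
    have hE : HasDerivAt (fun s : ℝ => h (s, p.2)) (h (0, p.2) * (2 * α * z.1)) 0 := by
      have h1 : HasDerivAt (fun s : ℝ => -α * ((s - z.1) ^ 2 + ‖p.2 - z.2‖ ^ 2))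
          (2 * α * z.1) 0 := by
        convert! ((((hasDerivAt_id (0 : ℝ)).sub_const z.1).pow 2).add_const
          (‖p.2 - z.2‖ ^ 2)).const_mul (-α) using 1
        simp
        ring
      exact h1.exp
    have hder := (hu.hasDerivAt_zero p (hKD hp) hpr.symm).add
      ((hE.const_mul ε).add ((hasDerivAt_id (0 : ℝ)).const_mul δ))
    refine not_eventually_le_of_hasDerivAt_pos hder ?_ ?_
    · have : 0 ≤ ε * (h (0, p.2) * (2 * α * z.1)) := by
        have : 0 < h (0, p.2) := Real.exp_pos _
        positivity
      linarith
    · have hpe : p = (0, p.2) := Prod.ext hpr.symm rfl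
      have hcont : Tendsto (fun s : ℝ => ((s, p.2) : WSpace k)) (𝓝 0) (𝓝 p) := by
        conv in 𝓝 p => rw [hpe]
        exact (by fun_prop : Continuous fun s : ℝ => ((s, p.2) : WSpace k)).continuousAt.tendsto
      filter_upwards [nhdsWithin_le_nhds (hcont.eventually hnhds), self_mem_nhdsWithin]
        with s hs hs0
      have h1 : u (s, p.2) + (ε * h (s, p.2) + δ * s) ≤ u p + (ε * h p + δ * p.1) :=
        hpmax ⟨Metric.ball_subset_closedBall hs, le_of_lt (show 0 < s from hs0)⟩
      rw [hpe] at h1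
      simpa using h1
  · have hloc : IsLocalMax (fun x => u x + (ε * Real.exp (-α * euclidSq (x - z)) + δ * x.1)) p := by
      refine hpmax.isLocalMax ?_
      filter_upwards [hnhds, (isOpen_lt continuous_const continuous_fst).mem_nhds hpr] with x h1 h2
      exact ⟨Metric.ball_subset_closedBall h1, le_of_lt h2⟩
    have hq : (k : ℝ) + 1 + a < 2 * α * euclidSq (p - z) :=
      hαc.trans_le (mul_le_mul_of_nonneg_left (hmin hp) (by positivity))
    have := weinstein_neg_of_isLocalMax ha hε hα hδ.le hpr hz
      (hu.contDiffAt p (hKD hp) hpr) hq hloc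
    linarith [hu.weinstein_nonneg p (hKD hp) hpr]

/-- The maximum propagates from a point with `r ≥ 0` to a half neighbourhood of it. -/
theorem eventually_eq_max_of_nonneg {k : ℕ} {a M : ℝ} {u : WSpace k → ℝ} {D : Set (WSpace k)}
    (ha : 0 ≤ a) (hu : HalfSubsolution a u D) (hD : IsOpen D) (hM : ∀ x ∈ D, u x ≤ M)
    {x₀ : WSpace k} (hx₀ : x₀ ∈ D) (hx₀r : 0 ≤ x₀.1) (hux₀ : u x₀ = M) :
    ∀ᶠ x in 𝓝 x₀, 0 ≤ x.1 → u x = M := by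
  obtain ⟨s₀, hs₀, hs₀D⟩ := Metric.isOpen_iff.mp hD x₀ hx₀
  set s := s₀ / 2 with hsdef
  have hs : 0 < s := by positivity
  have hKD : Metric.closedBall x₀ s ⊆ D := fun x hx =>
    hs₀D (lt_of_le_of_lt (Metric.mem_closedBall.mp hx) (by linarith))
  filter_upwards [Metric.ball_mem_nhds x₀ (by positivity : 0 < s / 3)] with z hz hzr
  have hzx₀ : ‖x₀ - z‖ < s / 3 := by rw [← dist_eq_norm, dist_comm]; exact hz
  have hzD : z ∈ D := hKD (Metric.ball_subset_closedBall
    (Metric.ball_subset_ball (by linarith) hz))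
  by_contra hne
  have hlt : u z < M := lt_of_le_of_ne (hM z hzD) hne
  have hsub : Continuous fun x : WSpace k => euclidSq (x - z) :=
    continuous_euclidSq.comp (continuous_id.sub continuous_const)
  -- `x₁` is a point of the contact set nearest to `z`
  set H := Metric.closedBall x₀ s ∩ {x : WSpace k | 0 ≤ x.1} with hH
  have hHc : IsClosed H :=
    Metric.isClosed_closedBall.inter (isClosed_le continuous_const continuous_fst)
  have hF : IsCompact (H ∩ u ⁻¹' {M}) :=
    (isCompact_closedBall x₀ s).of_isClosed_subset
      ((hu.continuousOn.mono (fun x hx => hKD hx.1)).preimage_isClosed_of_isClosed hHc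
        isClosed_singleton) (fun x hx => hx.1.1)
  have hx₀F : x₀ ∈ H ∩ u ⁻¹' {M} := ⟨⟨Metric.mem_closedBall_self hs.le, hx₀r⟩, hux₀⟩
  obtain ⟨x₁, hx₁, hmin⟩ := hF.exists_isMinOn ⟨x₀, hx₀F⟩ hsub.continuousOn
  have hmin₀ : euclidSq (x₁ - z) ≤ euclidSq (x₀ - z) := hmin hx₀F
  have hx₁z : x₁ ≠ z := by
    rintro rfl
    exact hne hx₁.2
  -- points at least as near to `z` as `x₀` do not leave the half ball
  have hstay : ∀ x : WSpace k, euclidSq (x - z) ≤ euclidSq (x₀ - z) →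
      x ∈ Metric.closedBall x₀ s := by
    intro x hx
    have h1 : ‖x - z‖ ^ 2 ≤ (2 * (s / 3)) ^ 2 := by
      have h2 := norm_sq_le_euclidSq (x - z)
      have h3 := euclidSq_le (x₀ - z)
      have h4 : ‖x₀ - z‖ ^ 2 ≤ (s / 3) ^ 2 := by gcongr
      nlinarith
    have h2 : ‖x - z‖ ≤ 2 * (s / 3) := (sq_le_sq₀ (norm_nonneg _) (by positivity)).mp h1
    have h3 : ‖x - x₀‖ ≤ ‖x - z‖ + ‖x₀ - z‖ := by
      have := norm_sub_le (x - z) (x₀ - z)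
      simpa using this
    rw [Metric.mem_closedBall, dist_eq_norm]
    linarith
  -- the ball with diameter from `z` to `x₁` meets the contact set in `x₁` only
  set z' : WSpace k := (1 / 2 : ℝ) • (z + x₁) with hz'
  have hz'r : 0 ≤ z'.1 := by
    have h1 : 0 ≤ x₁.1 := hx₁.1.2
    simp only [hz', Prod.smul_fst, Prod.fst_add, smul_eq_mul]
    positivity
  refine no_touching_point ha hu hD hM (hKD hx₁.1.1) hx₁.1.2 hx₁.2 hz'r ?_ ?_
  · intro heq
    apply hx₁z
    have h2 : (2 : ℝ) • x₁ = z + x₁ := by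
      conv_lhs => rw [heq, hz', smul_smul]
      norm_num
    rw [two_smul] at h2
    exact add_right_cancel h2
  · intro x hxr hx hxx₁
    have hpar := euclidSq_parallelogram (x - z') (x₁ - z')
    have h1 : x - z' + (x₁ - z') = x - z := by rw [hz']; module
    have h2 : x - z' - (x₁ - z') = x - x₁ := by abel
    have hpar₁ := euclidSq_parallelogram (x₁ - z') (x₁ - z')
    have h3 : x₁ - z' + (x₁ - z') = x₁ - z := by rw [hz']; module
    have h4 : euclidSq (0 : WSpace k) = 0 := by simp [euclidSq]
    rw [h1, h2] at hpar
    rw [h3, sub_self, h4] at hpar₁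
    have hpos := euclidSq_pos (sub_ne_zero.mpr hxx₁)
    have hcloser : euclidSq (x - z) < euclidSq (x₁ - z) := by linarith
    have hxs := hstay x (by linarith)
    refine lt_of_le_of_ne (hM x (hKD hxs)) fun hxM => ?_
    have : euclidSq (x₁ - z) ≤ euclidSq (x - z) := hmin ⟨⟨hxs, hxr⟩, hxM⟩
    linarith

/-! ### Reflection and conclusion -/

theorem continuous_reflectR {k : ℕ} : Continuous (reflectR (k := k)) := by
  unfold reflectR; fun_prop

theorem reflectR_reflectR {k : ℕ} (x : WSpace k) : reflectR (reflectR x) = x := by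
  simp [reflectR]

theorem weinstein_comp_reflectR {k : ℕ} (a : ℝ) (u : WSpace k → ℝ) (x : WSpace k) :
    weinstein a (u ∘ reflectR) x = weinstein a u (reflectR x) := by
  have h2 := iteratedDeriv_comp_neg 2 (fun s : ℝ => u (s, x.2)) x.1
  have h1 := deriv_comp_neg (fun s : ℝ => u (s, x.2)) x.1
  simp only [weinstein, Function.comp_def, reflectR]
  rw [h2, h1]
  simp [div_neg]

theorem HalfSubsolution.of_even {k : ℕ} {a : ℝ} {D J : Set (WSpace k)} {u : WSpace k → ℝ}
    (hD_open : IsOpen D) (hJ : J = D ∩ singularPlane k)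
    (hu_C2 : ContDiffOn ℝ 2 u (D \ J)) (hu_C1 : ContDiffOn ℝ 1 u D)
    (hu_even : ∀ p ∈ J, ∀ᶠ x in 𝓝 p, u x = u (reflectR x))
    (hLu : ∀ x ∈ D \ J, 0 ≤ weinstein a u x) : HalfSubsolution a u D := by
  have hmem : ∀ p ∈ D, 0 < p.1 → p ∈ D \ J := by
    rintro p hp hr
    refine ⟨hp, fun hpJ => ?_⟩
    rw [hJ] at hpJ
    exact hr.ne' hpJ.2
  have hopen : IsOpen (D \ J) := by
    have : D \ J = D ∩ {x : WSpace k | x.1 = 0}ᶜ := by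
      rw [hJ]; ext x; simp [singularPlane]
    rw [this]
    exact hD_open.inter (isClosed_eq continuous_fst continuous_const).isOpen_compl
  refine ⟨hu_C1.continuousOn, fun p hp hr => hu_C2.contDiffAt (hopen.mem_nhds (hmem p hp hr)),
    fun p hp hr => hLu p (hmem p hp hr), fun p hp hr => ?_⟩
  have hpe : ((0 : ℝ), p.2) = p := Prod.ext hr.symm rfl
  have hdiff : DifferentiableAt ℝ (fun s : ℝ => u (s, p.2)) 0 := by
    refine DifferentiableAt.comp (0 : ℝ) (f := fun s : ℝ => ((s, p.2) : WSpace k)) ?_ (by fun_prop)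
    rw [hpe]
    exact (hu_C1.contDiffAt (hD_open.mem_nhds hp)).differentiableAt (by simp)
  -- an even function has vanishing derivative at the origin
  have hev : (fun s : ℝ => u (s, p.2)) =ᶠ[𝓝 0] fun s => u (-s, p.2) := by
    have hc : Tendsto (fun s : ℝ => ((s, p.2) : WSpace k)) (𝓝 0) (𝓝 p) := by
      have := (by fun_prop : Continuous
        fun s : ℝ => ((s, p.2) : WSpace k)).continuousAt (x := 0)
      rwa [ContinuousAt, hpe] at this
    exact hc.eventually (hu_even p (hJ ▸ ⟨hp, hr⟩))
  have h1 := hev.deriv_eq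
  rw [deriv_comp_neg (fun s : ℝ => u (s, p.2)) 0, neg_zero] at h1
  have h2 : deriv (fun s : ℝ => u (s, p.2)) 0 = 0 := by linarith
  simpa [h2] using hdiff.hasDerivAt

theorem HalfSubsolution.comp_reflectR {k : ℕ} {a : ℝ} {D J : Set (WSpace k)} {u : WSpace k → ℝ}
    (hD_open : IsOpen D) (hD_symm : ∀ x ∈ D, reflectR x ∈ D) (hJ : J = D ∩ singularPlane k)
    (hu_C2 : ContDiffOn ℝ 2 u (D \ J)) (hu_C1 : ContDiffOn ℝ 1 u D)
    (hu_even : ∀ p ∈ J, ∀ᶠ x in 𝓝 p, u x = u (reflectR x))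
    (hLu : ∀ x ∈ D \ J, 0 ≤ weinstein a u x) : HalfSubsolution a (u ∘ reflectR) D := by
  have hsmooth : ∀ n, ContDiff ℝ n (reflectR (k := k)) := fun n => by
    unfold reflectR; fun_prop
  have hmaps : MapsTo reflectR (D \ J) (D \ J) := by
    rintro x ⟨hx, hxJ⟩
    refine ⟨hD_symm x hx, fun h => hxJ ?_⟩
    rw [hJ] at h ⊢
    have h0 : -x.1 = 0 := h.2
    exact ⟨hx, neg_eq_zero.mp h0⟩
  refine HalfSubsolution.of_even hD_open hJ (hu_C2.comp (hsmooth 2).contDiffOn hmaps)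
    (hu_C1.comp (hsmooth 1).contDiffOn hD_symm) (fun p hp => ?_) (fun x hx => ?_)
  · filter_upwards [hu_even p hp] with x hx
    simp only [Function.comp, reflectR_reflectR, hx]
  · rw [weinstein_comp_reflectR]
    exact hLu _ (hmaps hx)

theorem theorem3p4 (k : ℕ) (a : ℝ) (ha : 0 ≤ a)
    (D J : Set (WSpace k))
    (hD_open : IsOpen D) (hD_conn : IsConnected D) (hD_bdd : Bornology.IsBounded D)
    (hD_symm : ∀ x ∈ D, reflectR x ∈ D)
    (hJ : J = D ∩ singularPlane k) (hJ_ne : J.Nonempty)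
    (u : WSpace k → ℝ)
    (hu_C2 : ContDiffOn ℝ 2 u (D \ J)) (hu_C1 : ContDiffOn ℝ 1 u D)
    (hu_even : ∀ p ∈ J, ∀ᶠ x in 𝓝 p, u x = u (reflectR x))
    (hLu : ∀ x ∈ D \ J, 0 ≤ weinstein a u x) :
    StrongMaxPrinciple u D := by
  intro x₀ hx₀ hmax
  have hpos := HalfSubsolution.of_even hD_open hJ hu_C2 hu_C1 hu_even hLu
  have hneg := HalfSubsolution.comp_reflectR hD_open hD_symm hJ hu_C2 hu_C1 hu_even hLu
  have hP : ∀ p ∈ D, u p = u x₀ → 0 ≤ p.1 → ∀ᶠ x in 𝓝 p, 0 ≤ x.1 → u x = u x₀ :=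
    fun p hp hup hr => eventually_eq_max_of_nonneg ha hpos hD_open hmax hp hr hup
  have hN : ∀ p ∈ D, u p = u x₀ → p.1 ≤ 0 → ∀ᶠ x in 𝓝 p, x.1 ≤ 0 → u x = u x₀ := by
    intro p hp hup hr
    have h1 := eventually_eq_max_of_nonneg ha hneg hD_open (fun x hx => hmax _ (hD_symm x hx))
      (hD_symm p hp) (show 0 ≤ -p.1 by linarith)
      (show u (reflectR (reflectR p)) = u x₀ by rw [reflectR_reflectR, hup])
    filter_upwards [continuous_reflectR.continuousAt.eventually h1] with x hx hxr
    have h2 := hx (show 0 ≤ -x.1 by linarith)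
    rwa [Function.comp, reflectR_reflectR] at h2
  have hopen : IsOpen {x | x ∈ D ∧ u x = u x₀} := by
    refine isOpen_iff_mem_nhds.mpr fun p ⟨hp, hup⟩ => ?_
    have hDp := hD_open.mem_nhds hp
    rcases lt_trichotomy p.1 0 with hr | hr | hr
    · filter_upwards [hDp, hN p hp hup hr.le,
        (isOpen_lt continuous_fst continuous_const).mem_nhds hr] with x h1 h2 h3
      exact ⟨h1, h2 (le_of_lt h3)⟩
    · filter_upwards [hDp, hN p hp hup hr.le, hP p hp hup hr.ge] with x h1 h2 h3
      exact ⟨h1, (le_total x.1 0).elim h2 h3⟩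
    · filter_upwards [hDp, hP p hp hup hr.le,
        (isOpen_lt continuous_const continuous_fst).mem_nhds hr] with x h1 h2 h3
      exact ⟨h1, h2 (le_of_lt h3)⟩
  have hsub := hD_conn.isPreconnected.subset_of_closure_inter_subset hopen
    ⟨x₀, hx₀, hx₀, rfl⟩ (by
      rintro x ⟨hxc, hxD⟩
      refine ⟨hxD, ?_⟩
      have hc : ContinuousAt u x := hu_C1.continuousOn.continuousAt (hD_open.mem_nhds hxD)
      by_contra hne
      obtain ⟨y, hy, hy'⟩ :=
        ((mem_closure_iff_frequently.mp hxc).and_eventually (hc.eventually_ne hne)).exists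
      exact hy' hy.2)
  exact fun x hx => (hsub hx).2
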